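/- Let $\varepsilon>0$ and let $f\colon\mathbb R\to\mathbb R$ satisfy $$|f(x+y)-f(x)-f(y)|\le\varepsilon\qquad(x,y\in\mathbb R).$$ Let $\xi\colon D\to\mathbb R$ be one of the following ten functions, where $D$ is the set on which $\xi$ and its derivative $\xi'$ are defined: $a^x$ with a fixed real $a>0$, $a\neq1$; $\cos x$; $\sin x$; $\cosh x$; $\sinh x$ (each with $D=\mathbb R$); $\ln x$ ($D=(0,\infty)$); $\arccos x$; $\arcsin x$ (each with $D=(-1,1)$); $\operatorname{arcosh}x$ ($D=(1,\infty)$); $\operatorname{arsinh}x$ ($D=\mathbb R$). Suppose that the mapping $$D\ni x\longmapsto f(\xi(x))-\xi'(x)f(x)$$ is locally bounded on $D$, i.e. every point of $D$ has a neighbourhood in $D$ on which the mapping is bounded. Then there exist $\lambda\in\mathbb R$ and a real derivation $\chi\colon\mathbb R\to\mathbb R$ (that is, $\chi(x+y)=\chi(x)+\chi(y)$ and $\chi(xy)=\chi(x)y+x\chi(y)$ for all $x,y\in\mathbb R$) such that $$|f(x)-[\chi(x)+\lambda x]|\le\varepsilon\qquad(x\in\mathbb R).$$ -/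

import Mathlib

open Topology

/-- A real function `g` is locally bounded on the set `D` (its domain): every point of `D` has a
neighbourhood in `D` on which `g` is bounded. -/
def LocallyBoundedOn (g : ℝ → ℝ) (D : Set ℝ) : Prop :=
  ∀ x ∈ D, ∃ U ∈ 𝓝[D] x, ∃ C : ℝ, ∀ y ∈ U, |g y| ≤ C

/-- `IsListedElementary ξ D`: the function `ξ` is one of the ten listed elementary functions, and
`D` is the set on which `ξ` and its derivative `ξ'` are defined.  For `ln` this is `(0, ∞)`, for
`arccos` and `arcsin` it is `(-1, 1)`, for `arcosh` it is `(1, ∞)`, and it is `ℝ` for the others. -/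
inductive IsListedElementary : (ℝ → ℝ) → Set ℝ → Prop
  | exp (a : ℝ) (ha : 0 < a) (ha1 : a ≠ 1) : IsListedElementary (fun x => a ^ x) Set.univ
  | cos : IsListedElementary Real.cos Set.univ
  | sin : IsListedElementary Real.sin Set.univ
  | cosh : IsListedElementary Real.cosh Set.univ
  | sinh : IsListedElementary Real.sinh Set.univ
  | log : IsListedElementary Real.log (Set.Ioi 0)
  | arccos : IsListedElementary Real.arccos (Set.Ioo (-1) 1)
  | arcsin : IsListedElementary Real.arcsin (Set.Ioo (-1) 1)
  | arcosh : IsListedElementary Real.arcosh (Set.Ioi 1)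
  | arsinh : IsListedElementary Real.arsinh Set.univ

open Filter Asymptotics

/-! Hyers' theorem gives an additive `A` within `ε` of `f`; the claim is that `B x = A x - A 1 * x`
is a derivation. Passing from `f` to `B` keeps `B (ξ x) - ξ' x * B x` locally bounded. If `ξ` solves
Wilson's equation with factor `C`, adding these expressions at `x + y` and `x - y` shows that the
additive map `u ↦ B (2 * C y * u) - 2 * C y * B u` is bounded near `ξ x₀`, hence linear. As `B 1 =
0`, this is the Leibniz rule for `2 * C y` against every `u`. The `v` obeying that rule form an
additive subgroup; it contains an interval of values `2 * C y`, so it is `ℝ`. Inverse functions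
reduce to this case. -/

/-- **Hyers' theorem**: an approximately additive real function is uniformly close to an additive
one. -/
theorem exists_addMonoidHom_abs_sub_le {f : ℝ → ℝ} {ε : ℝ}
    (hf : ∀ x y : ℝ, |f (x + y) - f x - f y| ≤ ε) :
    ∃ A : ℝ →+ ℝ, ∀ x, |f x - A x| ≤ ε := by
  set u : ℝ → ℕ → ℝ := fun x n => f (2 ^ n * x) / 2 ^ n with hu
  -- These bounds sum over `n ≥ 0` to exactly `ε`.
  have hstep (x : ℝ) (n : ℕ) : dist (u x n) (u x (n + 1)) ≤ ε / 2 / 2 ^ n := by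
    have h := hf (2 ^ n * x) (2 ^ n * x)
    have h2 : (0 : ℝ) < 2 ^ n := by positivity
    have e : u x n - u x (n + 1)
        = -((f (2 ^ n * x + 2 ^ n * x) - f (2 ^ n * x) - f (2 ^ n * x)) / 2 / 2 ^ n) := by
      have : (2 : ℝ) ^ (n + 1) * x = 2 ^ n * x + 2 ^ n * x := by ring
      simp only [hu]
      rw [this, pow_succ]
      field_simp
      ring
    rw [Real.dist_eq, e, abs_neg, abs_div, abs_div, abs_of_pos h2, abs_two]
    gcongr
  choose A hA using fun x => cauchySeq_tendsto_of_complete (cauchySeq_of_le_geometric_two (hstep x))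
  have hadd (x y : ℝ) : A (x + y) = A x + A y := by
    have h0 : Tendsto (fun n : ℕ => ε / 2 ^ n) atTop (𝓝 0) :=
      tendsto_const_nhds.div_atTop (tendsto_pow_atTop_atTop_of_one_lt one_lt_two)
    have h1 : Tendsto (fun n => u (x + y) n - u x n - u y n) atTop (𝓝 0) := by
      refine squeeze_zero_norm (fun n => ?_) h0
      have h2 : (0 : ℝ) < 2 ^ n := by positivity
      simp only [hu, mul_add, Real.norm_eq_abs, ← sub_div, abs_div, abs_of_pos h2]
      gcongr
      exact hf _ _
    have h2 := tendsto_nhds_unique h1 (((hA (x + y)).sub (hA x)).sub (hA y))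
    linarith
  refine ⟨AddMonoidHom.mk' A hadd, fun x => ?_⟩
  have h := dist_le_of_le_geometric_two_of_tendsto₀ (hstep x) (hA x)
  simpa [hu, Real.dist_eq] using h

/-- An additive function that is bounded near some point is linear. -/
theorem AddMonoidHom.eq_mul_apply_one_of_isBigO (g : ℝ →+ ℝ) {p : ℝ}
    (hg : g =O[𝓝 p] fun _ => (1 : ℝ)) (u : ℝ) : g u = u * g 1 := by
  obtain ⟨c, hc⟩ := hg.bound
  have hev : ∀ᶠ h in 𝓝 (0 : ℝ), ‖g (p + h)‖ ≤ c * ‖(1 : ℝ)‖ :=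
    (by simpa using (continuous_const_add p).tendsto 0 :
      Tendsto (fun h => p + h) (𝓝 0) (𝓝 p)).eventually hc
  have hcont : Continuous g := by
    refine g.continuous_of_isBounded_nhds_zero hev ?_
    refine isBounded_iff_forall_norm_le.2 ⟨c + ‖g p‖, ?_⟩
    rintro _ ⟨h, hh, rfl⟩
    have e : g h = g (p + h) - g p := by simp
    have hh' : ‖g (p + h)‖ ≤ c := by simpa using hh
    rw [e]
    exact (norm_sub_le _ _).trans (by gcongr)
  simpa using map_real_smul g hcont u 1

/-- An additive subgroup of `ℝ` that is a neighbourhood of some point is everything. -/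
theorem AddSubgroup.eq_top_of_mem_nhds_real (S : AddSubgroup ℝ) {p : ℝ}
    (hS : (S : Set ℝ) ∈ 𝓝 p) : S = ⊤ := by
  have ho := S.isOpen_of_mem_nhds hS
  have := IsClopen.eq_univ ⟨S.isClosed_of_isOpen ho, ho⟩ ⟨0, S.zero_mem⟩
  exact SetLike.coe_injective (by simpa using this)

/-- `ξ` is a `C¹` function with derivative `ξ'` that solves d'Alembert's (Wilson's) equation
`ξ (x + y) + ξ (x - y) = 2 * C y * ξ x`, where `C` is `C¹` and not constant near `0`. -/
structure SolvesWilson (ξ ξ' C C' : ℝ → ℝ) : Prop where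
  hasDerivAt : ∀ x, HasDerivAt ξ (ξ' x) x
  continuous_deriv : Continuous ξ'
  add_sub : ∀ x y, ξ (x + y) + ξ (x - y) = 2 * C y * ξ x
  hasDerivAt_factor : ∀ y, HasDerivAt C (C' y) y
  continuous_deriv_factor : Continuous C'
  frequently_ne : ∃ᶠ y in 𝓝 0, C' y ≠ 0

namespace SolvesWilson

variable {ξ ξ' C C' : ℝ → ℝ}

theorem continuous (h : SolvesWilson ξ ξ' C C') : Continuous ξ :=
  continuous_iff_continuousAt.2 fun x => (h.hasDerivAt x).continuousAt

theorem hasStrictDerivAt (h : SolvesWilson ξ ξ' C C') (x : ℝ) : HasStrictDerivAt ξ (ξ' x) x :=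
  hasStrictDerivAt_of_hasDerivAt_of_continuousAt (Eventually.of_forall h.hasDerivAt)
    h.continuous_deriv.continuousAt

theorem hasStrictDerivAt_factor (h : SolvesWilson ξ ξ' C C') (y : ℝ) :
    HasStrictDerivAt C (C' y) y :=
  hasStrictDerivAt_of_hasDerivAt_of_continuousAt (Eventually.of_forall h.hasDerivAt_factor)
    h.continuous_deriv_factor.continuousAt

theorem deriv_add_sub (h : SolvesWilson ξ ξ' C C') (x y : ℝ) :
    ξ' (x + y) + ξ' (x - y) = 2 * C y * ξ' x := by
  have h1 : HasDerivAt (fun t => ξ (t + y) + ξ (t - y)) (ξ' (x + y) + ξ' (x - y)) x :=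
    ((h.hasDerivAt (x + y)).comp_add_const x y).add ((h.hasDerivAt (x - y)).comp_sub_const x y)
  simp only [h.add_sub] at h1
  exact h1.unique ((h.hasDerivAt x).const_mul (2 * C y))

/-- For fixed `y`, the additive function `u ↦ A (2 * C y * u) - 2 * C y * A u` is bounded near
`ξ x₀`, hence linear. -/
theorem map_two_mul_factor_mul (h : SolvesWilson ξ ξ' C C') {A : ℝ →+ ℝ} (hA1 : A 1 = 0)
    {x₀ y : ℝ} (hx₀ : ξ' x₀ ≠ 0)
    (h0 : (fun x => A (ξ x) - ξ' x * A x) =O[𝓝 x₀] fun _ => (1 : ℝ))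
    (hp : (fun x => A (ξ x) - ξ' x * A x) =O[𝓝 (x₀ + y)] fun _ => (1 : ℝ))
    (hm : (fun x => A (ξ x) - ξ' x * A x) =O[𝓝 (x₀ - y)] fun _ => (1 : ℝ)) (u : ℝ) :
    A (2 * C y * u) = 2 * C y * A u + u * A (2 * C y) := by
  set v : ℝ := 2 * C y with hv
  let g : ℝ →+ ℝ := A.comp (AddMonoidHom.mulLeft v) - (AddMonoidHom.mulLeft v).comp A
  have hg (t : ℝ) : g t = A (v * t) - v * A t := rfl
  have hp' := hp.comp_tendsto ((continuous_add_const y).tendsto x₀)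
  have hm' := hm.comp_tendsto ((continuous_sub_right y).tendsto x₀)
  -- Expanding `A (x ± y)` leaves this remainder, continuous in `x`; the `A x` terms cancel because
  -- `ξ'` solves the same equation.
  have hr : (fun x => (ξ' (x + y) - ξ' (x - y)) * A y) =O[𝓝 x₀] fun _ => (1 : ℝ) := by
    have hc := h.continuous_deriv
    have : Continuous fun x => (ξ' (x + y) - ξ' (x - y)) * A y := by fun_prop
    exact this.continuousAt.isBigO_one ℝ
  have hsum := ((hp'.add hm').sub (h0.const_mul_left v)).add hr
  have hgξ : (g ∘ ξ) =O[𝓝 x₀] ((fun _ => (1 : ℝ)) ∘ ξ) := by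
    refine hsum.congr_left fun x => ?_
    have e1 : A (v * ξ x) = A (ξ (x + y)) + A (ξ (x - y)) := by rw [hv, ← h.add_sub, map_add]
    have e2 := h.deriv_add_sub x y
    simp only [Function.comp_apply, hg, e1, map_add, map_sub]
    linear_combination (-A x) * e2
  have hgO : g =O[𝓝 (ξ x₀)] fun _ => (1 : ℝ) := by
    -- Since `ξ' x₀ ≠ 0`, `ξ` maps neighbourhoods of `x₀` onto neighbourhoods of `ξ x₀`.
    rw [← (h.hasStrictDerivAt x₀).map_nhds_eq hx₀]
    exact isBigO_map.2 hgξ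
  have := g.eq_mul_apply_one_of_isBigO hgO u
  rw [hg, hg, mul_one, hA1] at this
  linear_combination this

theorem leibniz (h : SolvesWilson ξ ξ' C C') {A : ℝ →+ ℝ} (hA1 : A 1 = 0) {D : Set ℝ}
    (hD : IsOpen D) {x₀ : ℝ} (hxD : x₀ ∈ D) (hx₀ : ξ' x₀ ≠ 0)
    (hO : ∀ x ∈ D, (fun x => A (ξ x) - ξ' x * A x) =O[𝓝 x] fun _ => (1 : ℝ)) (u v : ℝ) :
    A (u * v) = u * A v + v * A u := by
  let S : AddSubgroup ℝ :=
    { carrier := {v | ∀ u, A (v * u) = v * A u + u * A v}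
      zero_mem' := by simp
      add_mem' := by
        intro a b ha hb t
        simp only [add_mul, map_add, ha t, hb t]
        ring
      neg_mem' := by
        intro a ha t
        simp only [neg_mul, map_neg, ha t]
        ring }
  have hS : ∀ᶠ y in 𝓝 (0 : ℝ), 2 * C y ∈ S := by
    have tp : Tendsto (fun y : ℝ => x₀ + y) (𝓝 0) (𝓝 x₀) := by
      simpa using (continuous_const_add x₀).tendsto 0
    have tm : Tendsto (fun y : ℝ => x₀ - y) (𝓝 0) (𝓝 x₀) := by
      simpa using (continuous_sub_left x₀).tendsto 0
    filter_upwards [tp.eventually (hD.mem_nhds hxD), tm.eventually (hD.mem_nhds hxD)] with y hp hm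
    exact h.map_two_mul_factor_mul hA1 hx₀ (hO _ hxD) (hO _ hp) (hO _ hm)
  -- `C'` may vanish at `0`, as for `cos` and `cosh`, so a nearby `y` is used, where `C` is locally
  -- open.
  obtain ⟨y, hy0, hy⟩ := (h.frequently_ne.and_eventually hS.eventually_nhds).exists
  have hmem : (S : Set ℝ) ∈ 𝓝 (2 * C y) := by
    have hs := (h.hasStrictDerivAt_factor y).const_mul 2
    rw [← hs.map_nhds_eq (mul_ne_zero two_ne_zero hy0)]
    exact hy
  have hu : u ∈ S := by
    rw [S.eq_top_of_mem_nhds_real hmem]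
    exact AddSubgroup.mem_top u
  exact hu v

/-- Stability of derivations along a solution of Wilson's equation. -/
theorem exists_derivation (h : SolvesWilson ξ ξ' C C') {f : ℝ → ℝ} {ε : ℝ}
    (hf : ∀ x y : ℝ, |f (x + y) - f x - f y| ≤ ε) {D : Set ℝ}
    (hD : IsOpen D) {x₀ : ℝ} (hxD : x₀ ∈ D) (hx₀ : ξ' x₀ ≠ 0)
    (hO : ∀ x ∈ D, (fun x => f (ξ x) - ξ' x * f x) =O[𝓝 x] fun _ => (1 : ℝ)) :
    ∃ (l : ℝ) (χ : Derivation ℤ ℝ ℝ), ∀ x : ℝ, |f x - (χ x + l * x)| ≤ ε := by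
  obtain ⟨A, hA⟩ := exists_addMonoidHom_abs_sub_le hf
  -- Normalised to vanish at `1`, as a derivation must.
  let B : ℝ →+ ℝ := A - AddMonoidHom.mulLeft (A 1)
  have hB (x : ℝ) : B x = A x - A 1 * x := rfl
  have hbd (k : ℝ → ℝ) (x : ℝ) : (fun t => f (k t) - A (k t)) =O[𝓝 x] fun _ => (1 : ℝ) :=
    IsBigO.of_bound ε (Eventually.of_forall fun t => by simpa using hA (k t))
  have hBO : ∀ x ∈ D, (fun x => B (ξ x) - ξ' x * B x) =O[𝓝 x] fun _ => (1 : ℝ) := by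
    intro x hx
    have hc := h.continuous_deriv
    have hc0 := h.continuous
    have h1 : ξ' =O[𝓝 x] fun _ => (1 : ℝ) := hc.continuousAt.isBigO_one ℝ
    have h2 : (fun t => A 1 * (ξ t - ξ' t * t)) =O[𝓝 x] fun _ => (1 : ℝ) := by
      have : Continuous fun t => A 1 * (ξ t - ξ' t * t) := by fun_prop
      exact this.continuousAt.isBigO_one ℝ
    have h3 : (fun t => ξ' t * (f t - A t)) =O[𝓝 x] fun _ => (1 : ℝ) := by
      simpa using h1.mul (hbd (fun t => t) x)
    refine ((((hO x hx).sub (hbd ξ x)).add h3).sub h2).congr_left fun t => ?_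
    simp only [hB]
    ring
  have hL := h.leibniz (A := B) (by simp [hB]) hD hxD hx₀ hBO
  refine ⟨A 1, Derivation.mk' B.toIntLinearMap fun a b => by simpa using hL a b, fun x => ?_⟩
  have e : f x - (B x + A 1 * x) = f x - A x := by rw [hB]; ring
  exact (congrArg abs e).trans_le (hA x)

/-- The same for a local inverse `η` of a solution of Wilson's equation. -/
theorem exists_derivation_of_leftInverse (h : SolvesWilson ξ ξ' C C') {f : ℝ → ℝ} {ε : ℝ}
    (hf : ∀ x y : ℝ, |f (x + y) - f x - f y| ≤ ε) {η : ℝ → ℝ} {D E : Set ℝ}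
    (hD : IsOpen D) (hne : D.Nonempty) (hmaps : Set.MapsTo ξ D E)
    (hinv : Set.LeftInvOn η ξ D) (hη : ∀ x ∈ E, DifferentiableAt ℝ η x)
    (hO : ∀ x ∈ E, (fun x => f (η x) - deriv η x * f x) =O[𝓝 x] fun _ => (1 : ℝ)) :
    ∃ (l : ℝ) (χ : Derivation ℤ ℝ ℝ), ∀ x : ℝ, |f x - (χ x + l * x)| ≤ ε := by
  have hmul : ∀ t ∈ D, deriv η (ξ t) * ξ' t = 1 := by
    intro t ht
    have h1 := (hη _ (hmaps ht)).hasDerivAt.comp t (h.hasDerivAt t)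
    refine h1.unique ((hasDerivAt_id t).congr_of_eventuallyEq ?_)
    filter_upwards [hD.mem_nhds ht] with s hs using hinv hs
  obtain ⟨x₀, hxD⟩ := hne
  refine h.exists_derivation hf hD hxD (right_ne_zero_of_mul_eq_one (hmul x₀ hxD)) fun t ht => ?_
  -- The hypothesis at `ξ s`, multiplied by `-ξ' s`, becomes `f (ξ s) - ξ' s * f s`, since `deriv η
  -- (ξ s) * ξ' s = 1`.
  have h1 := (hO _ (hmaps ht)).comp_tendsto h.continuous.continuousAt
  have h2 : ξ' =O[𝓝 t] fun _ => (1 : ℝ) := h.continuous_deriv.continuousAt.isBigO_one ℝ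
  have h3 := (h2.mul h1).neg_left
  refine h3.congr' ?_ (by simp)
  filter_upwards [hD.mem_nhds ht] with s hs
  have e := hmul s hs
  simp only [Function.comp_apply, hinv hs]
  linear_combination f (ξ s) * e

end SolvesWilson

/-! ### Wilson's equation for the elementary functions -/

theorem frequently_sinh_ne_zero : ∃ᶠ y in 𝓝 (0 : ℝ), Real.sinh y ≠ 0 := by
  have : ∃ᶠ y in 𝓝[≠] (0 : ℝ), y ≠ 0 := Eventually.frequently self_mem_nhdsWithin
  exact (this.filter_mono nhdsWithin_le_nhds).mono fun y hy => by simpa using hy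

theorem frequently_neg_sin_ne_zero : ∃ᶠ y in 𝓝 (0 : ℝ), -Real.sin y ≠ 0 := by
  have : ∃ᶠ y in 𝓝[>] (0 : ℝ), y ∈ Set.Ioo 0 Real.pi :=
    Eventually.frequently (Ioo_mem_nhdsGT Real.pi_pos)
  exact (this.filter_mono nhdsWithin_le_nhds).mono fun y hy =>
    neg_ne_zero.2 (Real.sin_pos_of_mem_Ioo hy).ne'

theorem solvesWilson_cosh : SolvesWilson Real.cosh Real.sinh Real.cosh Real.sinh where
  hasDerivAt := Real.hasDerivAt_cosh
  continuous_deriv := Real.continuous_sinh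
  add_sub x y := by rw [Real.cosh_add, Real.cosh_sub]; ring
  hasDerivAt_factor := Real.hasDerivAt_cosh
  continuous_deriv_factor := Real.continuous_sinh
  frequently_ne := frequently_sinh_ne_zero

theorem solvesWilson_sinh : SolvesWilson Real.sinh Real.cosh Real.cosh Real.sinh where
  hasDerivAt := Real.hasDerivAt_sinh
  continuous_deriv := Real.continuous_cosh
  add_sub x y := by rw [Real.sinh_add, Real.sinh_sub]; ring
  hasDerivAt_factor := Real.hasDerivAt_cosh
  continuous_deriv_factor := Real.continuous_sinh
  frequently_ne := frequently_sinh_ne_zero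

theorem solvesWilson_cos :
    SolvesWilson Real.cos (fun x => -Real.sin x) Real.cos (fun x => -Real.sin x) where
  hasDerivAt := Real.hasDerivAt_cos
  continuous_deriv := Real.continuous_sin.neg
  add_sub x y := by rw [Real.cos_add, Real.cos_sub]; ring
  hasDerivAt_factor := Real.hasDerivAt_cos
  continuous_deriv_factor := Real.continuous_sin.neg
  frequently_ne := frequently_neg_sin_ne_zero

theorem solvesWilson_sin :
    SolvesWilson Real.sin Real.cos Real.cos (fun x => -Real.sin x) where
  hasDerivAt := Real.hasDerivAt_sin
  continuous_deriv := Real.continuous_cos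
  add_sub x y := by rw [Real.sin_add, Real.sin_sub]; ring
  hasDerivAt_factor := Real.hasDerivAt_cos
  continuous_deriv_factor := Real.continuous_sin.neg
  frequently_ne := frequently_neg_sin_ne_zero

theorem solvesWilson_exp_mul {c : ℝ} (hc : c ≠ 0) :
    SolvesWilson (fun x => Real.exp (c * x)) (fun x => Real.exp (c * x) * c)
      (fun x => Real.cosh (c * x)) (fun x => Real.sinh (c * x) * c) where
  hasDerivAt x := by
    simpa using ((hasDerivAt_id x).const_mul c).exp
  continuous_deriv := by fun_prop
  add_sub x y := by
    rw [Real.cosh_eq, mul_add, mul_sub, Real.exp_add, sub_eq_add_neg, Real.exp_add]; ring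
  hasDerivAt_factor y := by
    simpa using ((hasDerivAt_id y).const_mul c).cosh
  continuous_deriv_factor := by fun_prop
  frequently_ne := by
    have : ∃ᶠ y in 𝓝[≠] (0 : ℝ), y ≠ 0 := Eventually.frequently self_mem_nhdsWithin
    exact (this.filter_mono nhdsWithin_le_nhds).mono fun y hy =>
      mul_ne_zero (by simpa using ⟨hc, hy⟩) hc

theorem IsListedElementary.isOpen {ξ : ℝ → ℝ} {D : Set ℝ} (h : IsListedElementary ξ D) :
    IsOpen D := by
  cases h <;> first | exact isOpen_univ | exact isOpen_Ioi | exact isOpen_Ioo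

theorem LocallyBoundedOn.isBigO_one {g : ℝ → ℝ} {D : Set ℝ} (hD : IsOpen D)
    (hg : LocallyBoundedOn g D) {x : ℝ} (hx : x ∈ D) : g =O[𝓝 x] fun _ => (1 : ℝ) := by
  obtain ⟨U, hU, C, hC⟩ := hg x hx
  rw [hD.nhdsWithin_eq hx] at hU
  exact IsBigO.of_bound C (by filter_upwards [hU] with y hy; simpa using hC y hy)

theorem mainTheorem12 (ε : ℝ) (hε : 0 < ε) (f : ℝ → ℝ)
    (hA : ∀ x y : ℝ, |f (x + y) - f x - f y| ≤ ε)
    (ξ : ℝ → ℝ) (D : Set ℝ) (hξ : IsListedElementary ξ D)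
    (hB : LocallyBoundedOn (fun x => f (ξ x) - deriv ξ x * f x) D) :
    ∃ (l : ℝ) (χ : Derivation ℤ ℝ ℝ), ∀ x : ℝ, |f x - (χ x + l * x)| ≤ ε := by
  have hO := fun x hx => hB.isBigO_one hξ.isOpen (x := x) hx
  have direct {ξ' C C' : ℝ → ℝ} (h : SolvesWilson ξ ξ' C C') {x₀ : ℝ} (hxD : x₀ ∈ D)
      (hx₀ : ξ' x₀ ≠ 0) :
      ∃ (l : ℝ) (χ : Derivation ℤ ℝ ℝ), ∀ x : ℝ, |f x - (χ x + l * x)| ≤ ε := by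
    refine h.exists_derivation hA hξ.isOpen hxD hx₀ ?_
    simpa only [(h.hasDerivAt _).deriv] using hO
  cases hξ with
  | exp a ha ha1 =>
    have hlog : Real.log a ≠ 0 := Real.log_ne_zero_of_pos_of_ne_one ha ha1
    have h := solvesWilson_exp_mul hlog
    simp only [← Real.rpow_def_of_pos ha] at h
    exact direct h (Set.mem_univ 0) (by simpa using hlog)
  | cos => exact direct solvesWilson_cos (Set.mem_univ (Real.pi / 2)) (by simp)
  | sin => exact direct solvesWilson_sin (Set.mem_univ 0) (by simp)
  | cosh => exact direct solvesWilson_cosh (Set.mem_univ 1) (by simp)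
  | sinh => exact direct solvesWilson_sinh (Set.mem_univ 0) (by simp)
  | log =>
    refine (solvesWilson_exp_mul one_ne_zero).exists_derivation_of_leftInverse hA isOpen_univ
      Set.univ_nonempty (fun t _ => Real.exp_pos _) (fun t _ => ?_)
      (fun x hx => Real.differentiableAt_log (ne_of_gt hx)) hO
    simp
  | arccos =>
    refine solvesWilson_cos.exists_derivation_of_leftInverse hA (D := Set.Ioo 0 Real.pi) isOpen_Ioo
      (Set.nonempty_Ioo.2 Real.pi_pos) (fun t ht => ?_)
      (fun t ht => Real.arccos_cos ht.1.le ht.2.le)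
      (fun x hx => Real.differentiableAt_arccos.2 ⟨hx.1.ne', hx.2.ne⟩) hO
    constructor
    · simpa using Real.cos_lt_cos_of_nonneg_of_le_pi ht.1.le le_rfl ht.2
    · simpa using Real.cos_lt_cos_of_nonneg_of_le_pi le_rfl ht.2.le ht.1
  | arcsin =>
    have hpi := Real.pi_pos
    refine solvesWilson_sin.exists_derivation_of_leftInverse hA
      (D := Set.Ioo (-(Real.pi / 2)) (Real.pi / 2)) isOpen_Ioo
      (Set.nonempty_Ioo.2 (by linarith)) (fun t ht => ?_)
      (fun t ht => Real.arcsin_sin ht.1.le ht.2.le)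
      (fun x hx => Real.differentiableAt_arcsin.2 ⟨hx.1.ne', hx.2.ne⟩) hO
    constructor
    · simpa using Real.sin_lt_sin_of_lt_of_le_pi_div_two le_rfl ht.2.le ht.1
    · simpa using Real.sin_lt_sin_of_lt_of_le_pi_div_two ht.1.le le_rfl ht.2
  | arcosh =>
    exact solvesWilson_cosh.exists_derivation_of_leftInverse hA (D := Set.Ioi 0) isOpen_Ioi
      ⟨1, Set.mem_Ioi.2 one_pos⟩ (fun t ht => Real.one_lt_cosh.2 (ne_of_gt ht))
      (fun t ht => Real.arcosh_cosh (le_of_lt ht)) (fun x hx => Real.differentiableAt_arcosh hx) hO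
  | arsinh =>
    exact solvesWilson_sinh.exists_derivation_of_leftInverse hA isOpen_univ Set.univ_nonempty
      (fun t _ => Set.mem_univ _) (fun t _ => Real.arsinh_sinh t)
      (fun x _ => (Real.hasDerivAt_arsinh x).differentiableAt) hO
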